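/- **Notation.** Order $\mathbb{N}^n$ componentwise ($0\in\mathbb{N}$). A *standard shape* is a finite subset of $\mathbb{N}^n$ closed under $\le$, and a *skew shape* is a difference of two standard shapes. A skew shape $\sigma$ is *connected* if it is nonempty and any two of its points are joined by a path in $\sigma$ with steps $\pm e_i$; it is *abstract* if it is nonempty and its meet $\wedge\sigma\in\mathbb{N}^n$ is $0$ (so $\sigma=\sigma-\wedge\sigma$). Let $\pi:\mathbb{N}^3\to\mathbb{N}^2$ be the projection to the first two coordinates. For a skew shape $\sigma\subseteq\mathbb{N}^3$ let $\overline\sigma$ be its closure under $\le$, let $\underline\sigma=\overline\sigma\smallsetminus\sigma$, and let $\overline p_\sigma(a)$, $\underline p_\sigma(a)$ be the number of points of $\overline\sigma$, resp. $\underline\sigma$, lying over $a\in\mathbb{N}^2$. A *floor plan* $(\nu,b,c)$ consists of connected abstract skew shapes $\nu_1,\dots,\nu_\ell\subseteq\mathbb{N}^3$ and $b_1,\dots,b_\ell,c_1,\dots,c_\ell\in\mathbb{N}^2$ such that the sets $\pi(\nu_j)+b_j$ are pairwise disjoint and the sets $\pi(\nu_j)+c_j$ are pairwise disjoint. For $i\ne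 j$ write $\nu_i<_b\nu_j$ if $v\le w$ for some $v\in\pi(\nu_i)+b_i$, $w\in\pi(\nu_j)+b_j$, and then put $$h_b(i,j)=\max_{\substack{v\in\pi(\nu_i)+b_i,\ w\in\pi(\nu_j)+b_j\\ v\le w}}\bigl(\overline p_{\nu_j}(w-b_j)-\underline p_{\nu_i}(v-b_i)\bigr)\in\mathbb{Z}.$$ Let $h_b(j)=\max\sum_{r=1}^m h_b(i_{r-1},i_r)$, the maximum over all chains $\nu_{i_0}<_b\cdots<_b\nu_{i_m}$ with $m\ge0$, $i_0=j$; define $h_c$ in the same way from $c$. Assume that these maxima exist for all $j$; they are then nonnegative integers. Put $\mathbf b_j=(b_j,h_b(j))$ and $\mathbf c_j=(c_j,h_c(j))$ in $\mathbb{N}^3$; $(\nu,\mathbf b,\mathbf c)$ is the *canonical realization* of $(\nu,b,c)$. Let $\zeta=\bigcup_j(\nu_j+\mathbf b_j)$ and $\xi=\bigcup_j(\nu_j+\mathbf c_j)$, and let $\lambda$ and $\mu$ be the closures of $\zeta$ and $\xi$ under $\le$. Let $k$ be a field and $S=k[x_1,x_2,x_3]$. Let $I,J,K,L\subseteq S$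 be the ideals generated by the monomials with exponents outside $\lambda$, $\mu$, $\lambda\smallsetminus\zeta$, $\mu\smallsetminus\xi$ respectively. **Theorem.** Let $(\nu,b,c)$ be a floor plan for which all the maxima $h_b(j)$ and $h_c(j)$ exist, and suppose that it is right-free, i.e. $h_b(j)\le 0$ for all $j$. Then: 1. The canonical realization gives rise to a module: the sets $\nu_j+\mathbf b_j$ are pairwise disjoint and closed under $\ge$ in $\lambda$, the sets $\nu_j+\mathbf c_j$ are pairwise disjoint and closed under $\ge$ in $\mu$, and there is an $S$-module isomorphism $\varphi:K/I\to L/J$ with $\varphi(x^{w+\mathbf b_j})=x^{w+\mathbf c_j}$ for all $j$ and all $w\in\nu_j$. 2. $|\nu_1|+\cdots+|\nu_\ell|\le|\lambda\cap\mu|$. 3. The floor plan is not a counterexample: for every such $\varphi$, the module $N=(S/I\oplus S/J)/\langle(f,-\varphi(f)):f\in K/I\rangle$ satisfies $\dim_k(S/\operatorname{Ann}(N))\le\dim_k N$. -/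

import Mathlib

/-- A standard shape (Young diagram): a finite subset of `ℕⁿ` closed under `≤`. -/
def IsStandardShape {n : ℕ} (σ : Finset (Fin n → ℕ)) : Prop :=
  IsLowerSet (σ : Set (Fin n → ℕ))

/-- A skew shape: the difference of two standard shapes. -/
def IsSkewShape {n : ℕ} (σ : Finset (Fin n → ℕ)) : Prop :=
  ∃ α β : Finset (Fin n → ℕ), IsStandardShape α ∧ IsStandardShape β ∧ σ = α \ β

/-- `v` and `w` differ by `± e_i` for some standard basis vector `e_i`. -/
def IsUnitStep {n : ℕ} (v w : Fin n → ℕ) : Prop :=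
  ∃ i : Fin n, w = v + Pi.single i 1 ∨ v = w + Pi.single i 1

/-- `v` and `w` are joined by a path of unit steps inside `σ`. -/
def JoinedInShape {n : ℕ} (σ : Finset (Fin n → ℕ)) (v w : Fin n → ℕ) : Prop :=
  Relation.ReflTransGen (fun x y => x ∈ σ ∧ y ∈ σ ∧ IsUnitStep x y) v w

/-- `σ` has exactly one connected component. -/
def IsConnectedShape {n : ℕ} (σ : Finset (Fin n → ℕ)) : Prop :=
  σ.Nonempty ∧ ∀ v ∈ σ, ∀ w ∈ σ, JoinedInShape σ v w

/-- An abstract skew shape: nonempty and equal to its translate `σ - ⋀ σ`.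
The subtraction is exact since `⋀ σ ≤ v` for all `v ∈ σ`. -/
def IsAbstractSkewShape {n : ℕ} (σ : Finset (Fin n → ℕ)) : Prop :=
  IsSkewShape σ ∧ ∃ h : σ.Nonempty, σ = σ.image (fun v => v - σ.inf' h id)

/-- The translate `σ + a`. -/
def shiftShape {n : ℕ} (σ : Finset (Fin n → ℕ)) (a : Fin n → ℕ) : Finset (Fin n → ℕ) :=
  σ.image (fun v => v + a)

/-- The closure of `σ` under `≤`. -/
def downClosure {n : ℕ} (σ : Finset (Fin n → ℕ)) : Finset (Fin n → ℕ) :=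
  σ.biUnion (fun v => Finset.Icc 0 v)

/-- The projection `ℕ³ → ℕ²` onto the first two coordinates. -/
def proj (a : Fin 3 → ℕ) : Fin 2 → ℕ := ![a 0, a 1]

/-- The point `(a, z) ∈ ℕ³` for `a ∈ ℕ²`. -/
def lift3 (a : Fin 2 → ℕ) (z : ℕ) : Fin 3 → ℕ := ![a 0, a 1, z]

/-- The upper height function: the number of points of the closure of `σ` above `a`. -/
def upperHeight (σ : Finset (Fin 3 → ℕ)) (a : Fin 2 → ℕ) : ℕ :=
  ((downClosure σ).filter fun v => proj v = a).card

/-- The lower height function: the number of points above `a` of the complement of `σ` in its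
closure. -/
def lowerHeight (σ : Finset (Fin 3 → ℕ)) (a : Fin 2 → ℕ) : ℕ :=
  ((downClosure σ \ σ).filter fun v => proj v = a).card

/-- The projection `π(σ) ⊆ ℕ²` of `σ ⊆ ℕ³`. -/
def projShape (σ : Finset (Fin 3 → ℕ)) : Finset (Fin 2 → ℕ) := σ.image proj

/-- A floor plan `(ν, b, c)`. -/
structure FloorPlan (ℓ : ℕ) where
  ν : Fin ℓ → Finset (Fin 3 → ℕ)
  b : Fin ℓ → (Fin 2 → ℕ)
  c : Fin ℓ → (Fin 2 → ℕ)
  abstract_ν : ∀ j, IsAbstractSkewShape (ν j)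
  connected_ν : ∀ j, IsConnectedShape (ν j)
  disjoint_b : ∀ i j, i ≠ j →
    Disjoint (shiftShape (projShape (ν i)) (b i)) (shiftShape (projShape (ν j)) (b j))
  disjoint_c : ∀ i j, i ≠ j →
    Disjoint (shiftShape (projShape (ν i)) (c i)) (shiftShape (projShape (ν j)) (c j))

/-- The relation `ν_i ≤_b ν_j` on indices. -/
def planLE {ℓ : ℕ} (ν : Fin ℓ → Finset (Fin 3 → ℕ)) (b : Fin ℓ → (Fin 2 → ℕ))
    (i j : Fin ℓ) : Prop :=
  ∃ v ∈ shiftShape (projShape (ν i)) (b i), ∃ w ∈ shiftShape (projShape (ν j)) (b j), v ≤ w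

/-- The relation `ν_i <_b ν_j` on indices. -/
def planLT {ℓ : ℕ} (ν : Fin ℓ → Finset (Fin 3 → ℕ)) (b : Fin ℓ → (Fin 2 → ℕ))
    (i j : Fin ℓ) : Prop :=
  planLE ν b i j ∧ i ≠ j

/-- The pairs `(v, w)` over which the maximum defining `h_b(i, j)` is taken. -/
def heightWitnesses {ℓ : ℕ} (ν : Fin ℓ → Finset (Fin 3 → ℕ)) (b : Fin ℓ → (Fin 2 → ℕ))
    (i j : Fin ℓ) : Finset ((Fin 2 → ℕ) × (Fin 2 → ℕ)) :=
  {p ∈ shiftShape (projShape (ν i)) (b i) ×ˢ shiftShape (projShape (ν j)) (b j) |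
    ∀ t, p.1 t ≤ p.2 t}

/-- The relative height `h_b(i, j)`, which may be negative. It is only used when `ν_i <_b ν_j`, in
which case the set of pairs is nonempty. The subtractions inside the height functions are exact,
since `v` and `w` lie in the translates by `b i` and `b j`. -/
def relHeight {ℓ : ℕ} (ν : Fin ℓ → Finset (Fin 3 → ℕ)) (b : Fin ℓ → (Fin 2 → ℕ))
    (i j : Fin ℓ) : ℤ :=
  if h : (heightWitnesses ν b i j).Nonempty then
    (heightWitnesses ν b i j).sup' h fun p =>
      (upperHeight (ν j) (p.2 - b j) : ℤ) - (lowerHeight (ν i) (p.1 - b i) : ℤ)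
  else 0

/-- `IsChainSum ν b j s`: there is a chain `ν_{i_0} <_b ⋯ <_b ν_{i_m}`, `m ≥ 0`, with `i_0 = j` and
`s = ∑_{r=1}^m h_b(i_{r-1}, i_r)`. -/
inductive IsChainSum {ℓ : ℕ} (ν : Fin ℓ → Finset (Fin 3 → ℕ)) (b : Fin ℓ → (Fin 2 → ℕ)) :
    Fin ℓ → ℤ → Prop
  | single (j : Fin ℓ) : IsChainSum ν b j 0
  | cons {i j : Fin ℓ} {s : ℤ} : planLT ν b i j → IsChainSum ν b j s →
      IsChainSum ν b i (relHeight ν b i j + s)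

/-- The maxima defining the heights `h_b(j)` exist: for every `j`, the sums over chains starting at
`j` are bounded above. (They are integers, and the trivial chain has sum `0`.) -/
def HasHeights {ℓ : ℕ} (ν : Fin ℓ → Finset (Fin 3 → ℕ)) (b : Fin ℓ → (Fin 2 → ℕ)) : Prop :=
  ∀ j, BddAbove {s : ℤ | IsChainSum ν b j s}

/-- The height `h_b(j)`: the maximum of the sums over all chains starting at `j`. It is only used
when these maxima exist; it is then a nonnegative integer. -/
noncomputable def planHeight {ℓ : ℕ} (ν : Fin ℓ → Finset (Fin 3 → ℕ)) (b : Fin ℓ → (Fin 2 → ℕ))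
    (j : Fin ℓ) : ℤ :=
  sSup {s : ℤ | IsChainSum ν b j s}

/-- The translation vectors `(b_j, h_b(j)) ∈ ℕ³`. -/
noncomputable def canonicalLift {ℓ : ℕ} (ν : Fin ℓ → Finset (Fin 3 → ℕ))
    (b : Fin ℓ → (Fin 2 → ℕ)) (j : Fin ℓ) : Fin 3 → ℕ :=
  lift3 (b j) (planHeight ν b j).toNat

/-- The union of the translates `ν_j + B_j`. -/
def unionShape {ℓ : ℕ} (ν : Fin ℓ → Finset (Fin 3 → ℕ)) (B : Fin ℓ → (Fin 3 → ℕ)) :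
    Finset (Fin 3 → ℕ) :=
  Finset.univ.biUnion fun j => shiftShape (ν j) (B j)

/-- The closure under `≤` of the union of the translates `ν_j + B_j`. -/
def sideShape {ℓ : ℕ} (ν : Fin ℓ → Finset (Fin 3 → ℕ)) (B : Fin ℓ → (Fin 3 → ℕ)) :
    Finset (Fin 3 → ℕ) :=
  downClosure (unionShape ν B)

/-- The translates `ν_j + B_j` are disjoint, and each is closed under `≥` in the closure of their
union. -/
def IsScaffold {ℓ : ℕ} (ν : Fin ℓ → Finset (Fin 3 → ℕ)) (B : Fin ℓ → (Fin 3 → ℕ)) : Prop :=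
  (∀ i j, i ≠ j → Disjoint (shiftShape (ν i) (B i)) (shiftShape (ν j) (B j))) ∧
  ∀ j, ∀ v ∈ shiftShape (ν j) (B j), ∀ u ∈ sideShape ν B, v ≤ u → u ∈ shiftShape (ν j) (B j)

/-- The monomial `x^a` in `k[x₁, x₂, x₃]`. -/
noncomputable def xpow (k : Type*) [Field k] (a : Fin 3 → ℕ) : MvPolynomial (Fin 3) k :=
  MvPolynomial.monomial (Finsupp.equivFunOnFinite.symm a) 1

/-- The monomial ideal generated by the monomials whose exponents are outside `σ`. For a standard
shape `σ`, this is the monomial ideal of finite colength corresponding to `σ`. -/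
noncomputable def shapeIdeal (k : Type*) [Field k] (σ : Finset (Fin 3 → ℕ)) :
    Ideal (MvPolynomial (Fin 3) k) :=
  Ideal.span (xpow k '' {a | a ∉ σ})

/-- `K / I`, as a submodule of `S / I`. -/
def subquotient {S : Type*} [CommRing S] (I K : Ideal S) : Submodule S (S ⧸ I) :=
  Submodule.map (Submodule.mkQ I) K

/-- The submodule `⟨(f, -φ(f)) : f ∈ K / I⟩` of `S / I ⊕ S / J`. -/
def gluingSubmodule {S : Type*} [CommRing S] {I J K L : Ideal S}
    (φ : subquotient I K ≃ₗ[S] subquotient J L) : Submodule S ((S ⧸ I) × (S ⧸ J)) :=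
  Submodule.span S (Set.range fun f : subquotient I K => ((f : S ⧸ I), -(φ f : S ⧸ J)))

/-- The module arising from `(I, J, K, L, φ)`: the gluing of `S / I` and `S / J` along `φ`. -/
abbrev GluedModule {S : Type*} [CommRing S] {I J K L : Ideal S}
    (φ : subquotient I K ≃ₗ[S] subquotient J L) : Type _ :=
  ((S ⧸ I) × (S ⧸ J)) ⧸ gluingSubmodule φ

/-- `N` violates `dim_k (S / Ann N) ≤ dim_k N`, where `S = k[x₁, x₂, x₃]`. -/
def IsCounterexampleModule.{u} (k : Type u) [Field k] (N : Type u) [AddCommGroup N]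
    [Module (MvPolynomial (Fin 3) k) N] [Module k N]
    [IsScalarTower k (MvPolynomial (Fin 3) k) N] : Prop :=
  ¬ Module.rank k (MvPolynomial (Fin 3) k ⧸ Module.annihilator (MvPolynomial (Fin 3) k) N) ≤
    Module.rank k N

/-- The module `K / I` on one side: `I` corresponds to the standard shape `λ`, the closure of the
union `ζ` of the `ν_j + B_j`, and `K` corresponds to `λ \ ζ`. -/
noncomputable abbrev sideModule (k : Type*) [Field k] {ℓ : ℕ} (ν : Fin ℓ → Finset (Fin 3 → ℕ))
    (B : Fin ℓ → (Fin 3 → ℕ)) :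
    Submodule (MvPolynomial (Fin 3) k)
      (MvPolynomial (Fin 3) k ⧸ shapeIdeal k (sideShape ν B)) :=
  subquotient (shapeIdeal k (sideShape ν B)) (shapeIdeal k (sideShape ν B \ unionShape ν B))

/-- `φ : K / I ≃ L / J` is the monomial isomorphism that translates each `ν_j + B_j` to
`ν_j + C_j`, i.e. `φ (x^{w + B_j}) = x^{w + C_j}` for `w ∈ ν_j`. -/
def IsTranslationMap {k : Type*} [Field k] {ℓ : ℕ} {ν : Fin ℓ → Finset (Fin 3 → ℕ)}
    {B C : Fin ℓ → (Fin 3 → ℕ)}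
    (φ : sideModule k ν B ≃ₗ[MvPolynomial (Fin 3) k] sideModule k ν C) : Prop :=
  ∀ j, ∀ w ∈ ν j, ∀ f : sideModule k ν B,
    (f : MvPolynomial (Fin 3) k ⧸ shapeIdeal k (sideShape ν B)) =
      Ideal.Quotient.mk _ (xpow k (w + B j)) →
    (φ f : MvPolynomial (Fin 3) k ⧸ shapeIdeal k (sideShape ν C)) =
      Ideal.Quotient.mk _ (xpow k (w + C j))

namespace FloorPlan

/-- The vectors `𝐛_j = (b_j, h_b(j))` of the canonical realization. -/
noncomputable def canonicalB {ℓ : ℕ} (F : FloorPlan ℓ) : Fin ℓ → (Fin 3 → ℕ) :=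
  canonicalLift F.ν F.b

/-- The vectors `𝐜_j = (c_j, h_c(j))` of the canonical realization. -/
noncomputable def canonicalC {ℓ : ℕ} (F : FloorPlan ℓ) : Fin ℓ → (Fin 3 → ℕ) :=
  canonicalLift F.ν F.c

/-- A floor plan is right-free if `h_b(j) ≤ 0` for all `j`. -/
def IsRightFree {ℓ : ℕ} (F : FloorPlan ℓ) : Prop :=
  ∀ j, planHeight F.ν F.b j ≤ 0

end FloorPlan

/-! Write |ν| for the sum of the |ν_j|. Statement 3 follows from statement 2. The glued submodule is
an image of K/I, which is spanned by |ν| monomials, so dim N ≥ |λ| + |μ| - |ν|. The ideal of λ ∪ μ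
kills N, so dim S/Ann(N) ≤ |λ ∪ μ|. By inclusion-exclusion, |ν| ≤ |λ ∩ μ| is enough
(`not_isCounterexampleModule`).

Everything about heights comes from `planHeight_add_lt`: if a point of one piece projects below a
point of another piece, then the second point sits strictly lower in the canonical realization.
Hence no point of a raised piece is ≤ a point of another one, which gives the scaffolds in statement
1. Translation of monomials is S-linear because multiplication by a monomial leaves a piece on both
sides at once, and then gives zero on both.

For statement 2, all h_b vanish, so points of different pieces on the same level have incomparable
b-projections. Thus a b-row or a b-column on one level meets only one piece. Group the points by
level and c-row, and rank each point within its group by its first c-coordinate. The points of rank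
h on level t inject into the column {(h, *, t)} of μ, via their c-row, and into the same column of
λ, via the lowest b-row that the group meets. Columns of lower sets are initial segments, so the
column of λ ∩ μ is the shorter of the two. Summing over (h, t) gives the bound
(`card_le_card_inter_of_placements`, `FloorPlan.sum_card_le`). -/

/-! ### Closures, translates and height functions of skew shapes -/

theorem subset_downClosure {n : ℕ} (σ : Finset (Fin n → ℕ)) : σ ⊆ downClosure σ := fun v hv =>
  Finset.mem_biUnion.2 ⟨v, hv, Finset.mem_Icc.2 ⟨zero_le, le_rfl⟩⟩

theorem mem_downClosure {n : ℕ} {σ : Finset (Fin n → ℕ)} {v : Fin n → ℕ} :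
    v ∈ downClosure σ ↔ ∃ w ∈ σ, v ≤ w := by
  simp [downClosure]

theorem isLowerSet_downClosure {n : ℕ} (σ : Finset (Fin n → ℕ)) :
    IsLowerSet (downClosure σ : Set (Fin n → ℕ)) := by
  intro v w hwv hv
  obtain ⟨u, hu, hvu⟩ := mem_downClosure.1 (Finset.mem_coe.1 hv)
  exact Finset.mem_coe.2 (mem_downClosure.2 ⟨u, hu, hwv.trans hvu⟩)

theorem mem_shiftShape {n : ℕ} {σ : Finset (Fin n → ℕ)} {a v : Fin n → ℕ} :
    v ∈ shiftShape σ a ↔ ∃ w ∈ σ, w + a = v := by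
  simp [shiftShape]

theorem add_mem_shiftShape {n : ℕ} {σ : Finset (Fin n → ℕ)} {a w : Fin n → ℕ} :
    w + a ∈ shiftShape σ a ↔ w ∈ σ := by
  rw [mem_shiftShape]
  constructor
  · rintro ⟨w', hw', h⟩
    rwa [← add_right_cancel h]
  · exact fun h => ⟨w, h, rfl⟩

theorem IsSkewShape.mem_of_le_of_le {n : ℕ} {σ : Finset (Fin n → ℕ)} (hσ : IsSkewShape σ)
    {v u w : Fin n → ℕ} (hv : v ∈ σ) (hw : w ∈ σ) (hvu : v ≤ u) (huw : u ≤ w) : u ∈ σ := by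
  obtain ⟨α, β, hα, hβ, rfl⟩ := hσ
  rw [Finset.mem_sdiff] at hv hw ⊢
  exact ⟨hα huw hw.1, fun h => hv.2 (hβ hvu h)⟩

/-- The closure contains all points below `v` in its column, at the `v 2 + 1` heights `0, …, v 2`.
-/
theorem lt_upperHeight {σ : Finset (Fin 3 → ℕ)} {v : Fin 3 → ℕ} (hv : v ∈ downClosure σ) :
    v 2 < upperHeight σ (proj v) := by
  have hsub : (Finset.range (v 2 + 1)).image (lift3 (proj v)) ⊆
      (downClosure σ).filter fun u => proj u = proj v := by
    intro u hu
    obtain ⟨z, hz, rfl⟩ := Finset.mem_image.1 hu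
    rw [Finset.mem_range] at hz
    refine Finset.mem_filter.2 ⟨isLowerSet_downClosure σ ?_ hv, ?_⟩
    · intro i
      fin_cases i <;> simp [lift3, proj]
      omega
    · simp [lift3, proj]
  have hcard := Finset.card_le_card hsub
  rw [Finset.card_image_of_injective, Finset.card_range] at hcard
  · exact hcard
  · intro z z' h
    simpa [lift3] using congrFun h 2

/-- Skew shapes are order-convex: a point of the closure above `v` in its column lies between two
points of `σ`, hence in `σ`. So the missing points all have height below `v 2`. -/
theorem lowerHeight_le {σ : Finset (Fin 3 → ℕ)} (hσ : IsSkewShape σ) {v : Fin 3 → ℕ}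
    (hv : v ∈ σ) : lowerHeight σ (proj v) ≤ v 2 := by
  rw [← Finset.card_range (v 2)]
  refine Finset.card_le_card_of_injOn (fun u => u 2) ?_ ?_
  · intro u hu
    simp only [Finset.coe_filter, Finset.mem_sdiff, Set.mem_ofPred_eq] at hu
    obtain ⟨⟨hu, huσ⟩, hp⟩ := hu
    simp only [Finset.coe_range, Set.mem_Iio]
    by_contra hlt
    obtain ⟨w, hw, huw⟩ := mem_downClosure.1 hu
    refine huσ (hσ.mem_of_le_of_le hv hw ?_ huw)
    have h0 := congrFun hp 0
    have h1 := congrFun hp 1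
    simp only [proj, Matrix.cons_val_zero, Matrix.cons_val_one] at h0 h1
    intro i
    fin_cases i
    · exact h0.ge
    · exact h1.ge
    · exact not_lt.1 hlt
  · intro u hu u' hu' h
    simp only [Finset.coe_filter, Set.mem_ofPred_eq] at hu hu'
    have hp := hu.2.trans hu'.2.symm
    have h0 := congrFun hp 0
    have h1 := congrFun hp 1
    simp only [proj, Matrix.cons_val_zero, Matrix.cons_val_one] at h0 h1
    funext i
    fin_cases i
    · exact h0
    · exact h1
    · exact h

/-! ### Heights of pieces and the scaffold property -/

section Heights

variable {ℓ : ℕ} {ν : Fin ℓ → Finset (Fin 3 → ℕ)} {b : Fin ℓ → (Fin 2 → ℕ)}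

theorem planHeight_nonneg (hb : HasHeights ν b) (j : Fin ℓ) : 0 ≤ planHeight ν b j :=
  le_csSup (hb j) (IsChainSum.single j)

theorem isChainSum_planHeight (hb : HasHeights ν b) (j : Fin ℓ) :
    IsChainSum ν b j (planHeight ν b j) :=
  Int.csSup_mem ⟨0, IsChainSum.single j⟩ (hb j)

theorem relHeight_add_planHeight_le (hb : HasHeights ν b) {i j : Fin ℓ} (hij : planLT ν b i j) :
    relHeight ν b i j + planHeight ν b j ≤ planHeight ν b i :=
  le_csSup (hb i) (IsChainSum.cons hij (isChainSum_planHeight hb j))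

/-- Prepending `i` to an optimal chain from `j` costs at least `upperHeight - lowerHeight` at the
two base points. The upper height exceeds `w 2` and the lower height is at most `v 2`. -/
theorem planHeight_add_lt (hν : ∀ j, IsSkewShape (ν j)) (hb : HasHeights ν b) {i j : Fin ℓ}
    (hij : i ≠ j) {v w : Fin 3 → ℕ} (hv : v ∈ ν i) (hw : w ∈ ν j)
    (hvw : proj v + b i ≤ proj w + b j) :
    planHeight ν b j + w 2 < planHeight ν b i + v 2 := by
  have hv' : proj v + b i ∈ shiftShape (projShape (ν i)) (b i) :=
    add_mem_shiftShape.2 (Finset.mem_image_of_mem _ hv)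
  have hw' : proj w + b j ∈ shiftShape (projShape (ν j)) (b j) :=
    add_mem_shiftShape.2 (Finset.mem_image_of_mem _ hw)
  have hmem : (proj v + b i, proj w + b j) ∈ heightWitnesses ν b i j :=
    Finset.mem_filter.2 ⟨Finset.mem_product.2 ⟨hv', hw'⟩, hvw⟩
  have hle := relHeight_add_planHeight_le hb ⟨⟨_, hv', _, hw', hvw⟩, hij⟩
  have hrel : (upperHeight (ν j) (proj w) : ℤ) - lowerHeight (ν i) (proj v) ≤
      relHeight ν b i j := by
    rw [relHeight, dif_pos ⟨_, hmem⟩]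
    have := Finset.le_sup' (fun p : (Fin 2 → ℕ) × (Fin 2 → ℕ) =>
      (upperHeight (ν j) (p.2 - b j) : ℤ) - (lowerHeight (ν i) (p.1 - b i) : ℤ)) hmem
    simpa only [add_tsub_cancel_right] using this
  have hu := lt_upperHeight (subset_downClosure _ hw)
  have hl := lowerHeight_le (hν i) hv
  omega

theorem proj_add_le_of_le {v w : Fin 3 → ℕ} {i j : Fin ℓ}
    (h : v + canonicalLift ν b i ≤ w + canonicalLift ν b j) : proj v + b i ≤ proj w + b j := by
  intro t
  fin_cases t
  · simpa [canonicalLift, lift3, proj] using h 0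
  · simpa [canonicalLift, lift3, proj] using h 1

theorem eq_of_add_canonicalLift_le (hν : ∀ j, IsSkewShape (ν j)) (hb : HasHeights ν b)
    {i j : Fin ℓ} {v w : Fin 3 → ℕ} (hv : v ∈ ν i) (hw : w ∈ ν j)
    (h : v + canonicalLift ν b i ≤ w + canonicalLift ν b j) : i = j := by
  by_contra hij
  have hlt := planHeight_add_lt hν hb hij hv hw (proj_add_le_of_le h)
  have h2 := h 2
  -- Nonnegativity makes `toNat` in the lift exact.
  have hi := planHeight_nonneg hb i
  have hj := planHeight_nonneg hb j
  simp [canonicalLift, lift3] at h2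
  omega

theorem mem_unionShape {B : Fin ℓ → (Fin 3 → ℕ)} {v : Fin 3 → ℕ} :
    v ∈ unionShape ν B ↔ ∃ j, ∃ w ∈ ν j, w + B j = v := by
  simp [unionShape, mem_shiftShape]

theorem mem_sideShape {B : Fin ℓ → (Fin 3 → ℕ)} {v : Fin 3 → ℕ} :
    v ∈ sideShape ν B ↔ ∃ j, ∃ w ∈ ν j, v ≤ w + B j := by
  rw [sideShape, mem_downClosure]
  constructor
  · rintro ⟨u, hu, hvu⟩
    obtain ⟨j, w, hw, rfl⟩ := mem_unionShape.1 hu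
    exact ⟨j, w, hw, hvu⟩
  · rintro ⟨j, w, hw, hv⟩
    exact ⟨_, mem_unionShape.2 ⟨j, w, hw, rfl⟩, hv⟩

theorem isLowerSet_sideShape (B : Fin ℓ → (Fin 3 → ℕ)) :
    IsLowerSet (sideShape ν B : Set (Fin 3 → ℕ)) :=
  isLowerSet_downClosure _

theorem isScaffold_canonicalLift (hν : ∀ j, IsSkewShape (ν j)) (hb : HasHeights ν b) :
    IsScaffold ν (canonicalLift ν b) := by
  constructor
  · intro i j hij
    rw [Finset.disjoint_left]
    intro u hi hj
    obtain ⟨v, hv, rfl⟩ := mem_shiftShape.1 hi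
    obtain ⟨w, hw, h⟩ := mem_shiftShape.1 hj
    exact hij (eq_of_add_canonicalLift_le hν hb hv hw h.ge)
  · intro i u hu t ht hut
    obtain ⟨v, hv, rfl⟩ := mem_shiftShape.1 hu
    obtain ⟨j, w, hw, htw⟩ := mem_sideShape.1 ht
    obtain rfl := eq_of_add_canonicalLift_le hν hb hv hw (hut.trans htw)
    obtain ⟨s, rfl⟩ := exists_add_of_le hut
    rw [add_right_comm] at htw ⊢
    exact add_mem_shiftShape.2
      ((hν i).mem_of_le_of_le hv hw le_self_add (le_of_add_le_add_right htw))

end Heights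

/-! ### The counting argument -/

theorem card_le_card_of_fiberwise {ε δ κ : Type*} [DecidableEq κ] (E : Finset ε) (U : Finset δ)
    (f : ε → κ) (g : δ → κ)
    (h : ∀ p, (E.filter fun e => f e = p).card ≤ (U.filter fun u => g u = p).card) :
    E.card ≤ U.card := by
  rw [Finset.card_eq_sum_card_fiberwise (f := f) (t := E.image f ∪ U.image g)
      (fun e he => Finset.mem_coe.2 (Finset.mem_union_left _ (Finset.mem_image_of_mem f he))),
    Finset.card_eq_sum_card_fiberwise (f := g) (t := E.image f ∪ U.image g)
      (fun e he => Finset.mem_coe.2 (Finset.mem_union_right _ (Finset.mem_image_of_mem g he)))]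
  exact Finset.sum_le_sum fun p _ => h p

/-- If natural numbers are pairwise distinct on a set of more than `h` elements, then one
of them is at least `h`. -/
theorem exists_le_of_lt_card {ε : Type*} {R : Finset ε} {x : ε → ℕ} {h : ℕ}
    (hx : Set.InjOn x R) (hR : h < R.card) : ∃ e ∈ R, h ≤ x e := by
  by_contra! hlt
  have := Finset.card_le_card_of_injOn (t := Finset.range h) x
    (fun e he => by simpa using hlt e he) hx
  rw [Finset.card_range] at this
  omega

/-- Two placements `e ↦ (bx e, by e, z e) ∈ A` and `e ↦ (cx e, cy e, z e) ∈ C` of a finite set in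
lower sets, such that in each level the first coordinates of the first placement are distinct on
each row of the second one, and each row of the first placement is contained in a row of the second
one. -/
theorem card_le_card_inter_of_placements {ε : Type*} (E : Finset ε) (bx bY cx cy z : ε → ℕ)
    (A C : Finset (Fin 3 → ℕ)) (hA : IsLowerSet (A : Set (Fin 3 → ℕ)))
    (hC : IsLowerSet (C : Set (Fin 3 → ℕ)))
    (hbA : ∀ e ∈ E, ![bx e, bY e, z e] ∈ A) (hcC : ∀ e ∈ E, ![cx e, cy e, z e] ∈ C)
    (hrow : ∀ e ∈ E, ∀ e' ∈ E, z e = z e' → bY e = bY e' → cy e = cy e')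
    (hbx : ∀ e ∈ E, ∀ e' ∈ E, z e = z e' → bx e = bx e' → cy e = cy e' → e = e')
    (hcx : ∀ e ∈ E, ∀ e' ∈ E, z e = z e' → cx e = cx e' → cy e = cy e' → e = e') :
    E.card ≤ (A ∩ C).card := by
  classical
  let row : ε → Finset ε := fun e => E.filter fun e' => z e' = z e ∧ cy e' = cy e
  let rank : ε → ℕ := fun e => ((row e).filter fun e' => cx e' < cx e).card
  have mem_row {e e' : ε} : e' ∈ row e ↔ e' ∈ E ∧ z e' = z e ∧ cy e' = cy e :=
    Finset.mem_filter
  have row_congr {e e' : ε} (hz : z e = z e') (hy : cy e = cy e') : row e = row e' := by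
    ext t
    rw [mem_row, mem_row, hz, hy]
  have rank_lt {e e' : ε} (he : e ∈ E) (hz : z e = z e') (hy : cy e = cy e')
      (hlt : cx e < cx e') : rank e < rank e' := by
    refine Finset.card_lt_card ((Finset.ssubset_iff_of_subset ?_).2 ⟨e, ?_, ?_⟩)
    · intro t ht
      rw [Finset.mem_filter, row_congr hz hy] at ht
      exact Finset.mem_filter.2 ⟨ht.1, ht.2.trans hlt⟩
    · exact Finset.mem_filter.2 ⟨mem_row.2 ⟨he, hz, hy⟩, hlt⟩
    · simp
  have rank_inj {e e' : ε} (he : e ∈ E) (he' : e' ∈ E) (hz : z e = z e') (hy : cy e = cy e')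
      (hr : rank e = rank e') : e = e' := by
    rcases lt_trichotomy (cx e) (cx e') with h | h | h
    · exact absurd hr (rank_lt he hz hy h).ne
    · exact hcx e he e' he' hz h hy
    · exact absurd hr (rank_lt he' hz.symm hy.symm h).ne'
  refine card_le_card_of_fiberwise E (A ∩ C) (fun e => (rank e, z e)) (fun v => (v 0, v 2)) ?_
  rintro ⟨h, t⟩
  -- Push each c-row to the left: the rank replaces the first coordinate and never exceeds it.
  have toC : (E.filter fun e => (rank e, z e) = (h, t)).card ≤
      (C.filter fun v => (v 0, v 2) = (h, t)).card := by
    refine Finset.card_le_card_of_injOn (fun e => ![rank e, cy e, z e]) ?_ ?_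
    · intro e he
      obtain ⟨he, hp⟩ := Finset.mem_filter.1 (Finset.mem_coe.1 he)
      refine Finset.mem_coe.2 (Finset.mem_filter.2 ⟨hC ?_ (hcC e he), by simpa using hp⟩)
      have hle : rank e ≤ cx e := by
        rw [← Finset.card_range (cx e)]
        refine Finset.card_le_card_of_injOn cx ?_ ?_
        · intro s hs
          simpa using (Finset.mem_filter.1 (Finset.mem_coe.1 hs)).2
        · intro s hs s' hs' hss
          obtain ⟨h1, h2, h3⟩ := mem_row.1 (Finset.mem_filter.1 (Finset.mem_coe.1 hs)).1
          obtain ⟨h1', h2', h3'⟩ := mem_row.1 (Finset.mem_filter.1 (Finset.mem_coe.1 hs')).1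
          exact hcx s h1 s' h1' (h2.trans h2'.symm) hss (h3.trans h3'.symm)
      intro i
      fin_cases i
      · exact hle
      · exact le_rfl
      · exact le_rfl
    · intro e he e' he' hee
      exact rank_inj (Finset.mem_filter.1 he).1 (Finset.mem_filter.1 he').1
        (congrFun hee 2) (congrFun hee 1) (congrFun hee 0)
  have hex : ∀ e ∈ E, ∃ s ∈ row e, ∀ s' ∈ row e, bY s ≤ bY s' := fun e he =>
    Finset.exists_min_image (row e) bY ⟨e, mem_row.2 ⟨he, rfl, rfl⟩⟩
  choose! low hlow hmin using hex
  have toA : (E.filter fun e => (rank e, z e) = (h, t)).card ≤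
      (A.filter fun v => (v 0, v 2) = (h, t)).card := by
    refine Finset.card_le_card_of_injOn (fun e => ![rank e, bY (low e), z e]) ?_ ?_
    · intro e he
      obtain ⟨he, hp⟩ := Finset.mem_filter.1 (Finset.mem_coe.1 he)
      have hinj : Set.InjOn bx (row e) := by
        intro s hs s' hs' hss
        obtain ⟨h1, h2, h3⟩ := mem_row.1 (Finset.mem_coe.1 hs)
        obtain ⟨h1', h2', h3'⟩ := mem_row.1 (Finset.mem_coe.1 hs')
        exact hbx s h1 s' h1' (h2.trans h2'.symm) hss (h3.trans h3'.symm)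
      have hlt : rank e < (row e).card := by
        refine Finset.card_lt_card ((Finset.filter_ssubset).2 ⟨e, ?_, lt_irrefl _⟩)
        exact mem_row.2 ⟨he, rfl, rfl⟩
      -- The group of `e` has more than `rank e` points, with distinct `bx`. So some point `s`
      -- dominates `(rank e, bY (low e))`, although `low e` itself need not.
      obtain ⟨s, hs, hle⟩ := exists_le_of_lt_card hinj hlt
      obtain ⟨h1, h2, h3⟩ := mem_row.1 hs
      refine Finset.mem_coe.2 (Finset.mem_filter.2 ⟨hA ?_ (hbA s h1), by simpa using hp⟩)
      intro i
      fin_cases i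
      · exact hle
      · exact hmin e he s hs
      · exact h2.ge
    · intro e he e' he' hee
      have heE := (Finset.mem_filter.1 he).1
      have heE' := (Finset.mem_filter.1 he').1
      have hz : z e = z e' := congrFun hee 2
      obtain ⟨h1, h2, h3⟩ := mem_row.1 (hlow e heE)
      obtain ⟨h1', h2', h3'⟩ := mem_row.1 (hlow e' heE')
      -- Lowest points in a common b-row lie in a common c-row, so both groups coincide and the rank
      -- determines the point.
      have hy := hrow _ h1 _ h1' (h2.trans (hz.trans h2'.symm)) (congrFun hee 1)
      exact rank_inj heE heE' hz (h3.symm.trans (hy.trans h3')) (congrFun hee 0)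
  -- The columns of `A` and `C` over `(h, t)` are initial segments, so one contains the other; the
  -- bound for the smaller one applies.
  by_cases hsub : (A.filter fun v => (v 0, v 2) = (h, t)) ⊆ C
  · refine toA.trans (Finset.card_le_card fun v hv => ?_)
    have hv' := Finset.mem_filter.1 hv
    exact Finset.mem_filter.2 ⟨Finset.mem_inter.2 ⟨hv'.1, hsub hv⟩, hv'.2⟩
  · refine toC.trans (Finset.card_le_card fun v hv => ?_)
    obtain ⟨a, ha, haC⟩ := Finset.not_subset.1 hsub
    obtain ⟨haA, hap⟩ := Finset.mem_filter.1 ha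
    obtain ⟨hvC, hvp⟩ := Finset.mem_filter.1 hv
    have hpa := hvp.trans hap.symm
    simp only [Prod.mk.injEq] at hpa
    refine Finset.mem_filter.2 ⟨Finset.mem_inter.2 ⟨?_, hvC⟩, hvp⟩
    rcases le_total (v 1) (a 1) with hle | hle
    · refine hA (fun i => ?_) haA
      fin_cases i
      · exact hpa.1.le
      · exact hle
      · exact hpa.2.le
    · refine absurd (hC (fun i => ?_) hvC) haC
      fin_cases i
      · exact hpa.1.ge
      · exact hle
      · exact hpa.2.ge

/-! ### The bound for right-free floor plans -/

theorem FloorPlan.isSkewShape {ℓ : ℕ} (F : FloorPlan ℓ) (j : Fin ℓ) : IsSkewShape (F.ν j) :=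
  (F.abstract_ν j).1

theorem FloorPlan.sum_card_le {ℓ : ℕ} (F : FloorPlan ℓ) (hb : HasHeights F.ν F.b)
    (hF : F.IsRightFree) :
    ∑ j, (F.ν j).card ≤ (sideShape F.ν F.canonicalB ∩ sideShape F.ν F.canonicalC).card := by
  rw [← Finset.card_sigma]
  have hzero (j : Fin ℓ) : planHeight F.ν F.b j = 0 := (hF j).antisymm (planHeight_nonneg hb j)
  -- With all b-heights zero, comparable projections of different pieces force different levels.
  have hcomp : ∀ {i j : Fin ℓ} {v w : Fin 3 → ℕ}, v ∈ F.ν i → w ∈ F.ν j → v 2 = w 2 →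
      v 0 + F.b i 0 ≤ w 0 + F.b j 0 → v 1 + F.b i 1 ≤ w 1 + F.b j 1 → i = j := by
    intro i j v w hv hw h2 h0 h1
    by_contra hij
    have := planHeight_add_lt F.isSkewShape hb hij hv hw (by
      intro t
      fin_cases t
      · simpa [proj] using h0
      · simpa [proj] using h1)
    rw [hzero, hzero] at this
    omega
  -- Omitting the vertical lift only lowers a point, so it stays in the closure. This lets both
  -- placements use the same level `e.2 2`, whatever the c-heights are.
  have hside (a : Fin ℓ → (Fin 2 → ℕ)) (e : (_ : Fin ℓ) × (Fin 3 → ℕ))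
      (he : e ∈ Finset.univ.sigma F.ν) :
      ![e.2 0 + a e.1 0, e.2 1 + a e.1 1, e.2 2] ∈ sideShape F.ν (canonicalLift F.ν a) := by
    refine mem_sideShape.2 ⟨e.1, e.2, (Finset.mem_sigma.1 he).2, fun i => ?_⟩
    fin_cases i <;> simp [canonicalLift, lift3]
  refine card_le_card_inter_of_placements (Finset.univ.sigma F.ν)
    (fun e => e.2 0 + F.b e.1 0) (fun e => e.2 1 + F.b e.1 1)
    (fun e => e.2 0 + F.c e.1 0) (fun e => e.2 1 + F.c e.1 1) (fun e => e.2 2) _ _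
    (isLowerSet_sideShape _) (isLowerSet_sideShape _) (hside F.b) (hside F.c) ?_ ?_ ?_
  · rintro ⟨i, v⟩ hv ⟨j, w⟩ hw hz hy
    replace hv := (Finset.mem_sigma.1 hv).2
    replace hw := (Finset.mem_sigma.1 hw).2
    dsimp only at hv hw hz hy ⊢
    -- In the same b-row, the first coordinates decide which point is the smaller one; either way
    -- the two are comparable.
    have hij : i = j := by
      rcases le_total (v 0 + F.b i 0) (w 0 + F.b j 0) with h | h
      · exact hcomp hv hw hz h hy.le
      · exact (hcomp hw hv hz.symm h hy.ge).symm
    subst hij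
    omega
  · rintro ⟨i, v⟩ hv ⟨j, w⟩ hw hz hx hy
    replace hv := (Finset.mem_sigma.1 hv).2
    replace hw := (Finset.mem_sigma.1 hw).2
    dsimp only at hv hw hz hx hy
    have hij : i = j := by
      rcases le_total (v 1 + F.b i 1) (w 1 + F.b j 1) with h | h
      · exact hcomp hv hw hz hx.le h
      · exact (hcomp hw hv hz.symm hx.ge h).symm
    subst hij
    congr 1
    funext t
    fin_cases t
    · exact add_right_cancel hx
    · exact add_right_cancel hy
    · exact hz
  · rintro ⟨i, v⟩ hv ⟨j, w⟩ hw hz hx hy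
    replace hv := (Finset.mem_sigma.1 hv).2
    replace hw := (Finset.mem_sigma.1 hw).2
    dsimp only at hv hw hz hx hy
    have hproj : proj v + F.c i = proj w + F.c j := by
      funext t
      fin_cases t
      · simpa [proj] using hx
      · simpa [proj] using hy
    have hij : i = j := by
      by_contra hij
      refine Finset.disjoint_left.1 (F.disjoint_c i j hij)
        (add_mem_shiftShape.2 (Finset.mem_image_of_mem _ hv)) ?_
      rw [hproj]
      exact add_mem_shiftShape.2 (Finset.mem_image_of_mem _ hw)
    subst hij
    congr 1
    funext t
    fin_cases t
    · exact add_right_cancel hx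
    · exact add_right_cancel hy
    · exact hz

/-! ### Monomial ideals and their colengths -/

section MonomialIdeals

variable (k : Type*) [Field k]

theorem xpow_add (a b : Fin 3 → ℕ) : xpow k (a + b) = xpow k a * xpow k b := by
  rw [xpow, xpow, xpow, MvPolynomial.monomial_mul, mul_one]
  congr 2
  ext i
  simp

theorem xpow_eq_basisMonomials (a : Fin 3 → ℕ) :
    xpow k a = MvPolynomial.basisMonomials (Fin 3) k (Finsupp.equivFunOnFinite.symm a) := by
  simp [xpow]

variable {k}

theorem xpow_mem_shapeIdeal {σ : Finset (Fin 3 → ℕ)} {a : Fin 3 → ℕ} (ha : a ∉ σ) :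
    xpow k a ∈ shapeIdeal k σ :=
  Ideal.subset_span ⟨a, ha, rfl⟩

theorem mem_shapeIdeal {σ : Finset (Fin 3 → ℕ)} (hσ : IsLowerSet (σ : Set (Fin 3 → ℕ)))
    {f : MvPolynomial (Fin 3) k} : f ∈ shapeIdeal k σ ↔ ∀ m ∈ f.support, (m : Fin 3 → ℕ) ∉ σ := by
  have himage : xpow k '' {a | a ∉ σ} = (fun m : Fin 3 →₀ ℕ => MvPolynomial.monomial m (1 : k)) ''
      {m | (m : Fin 3 → ℕ) ∉ σ} := by
    ext g
    constructor
    · rintro ⟨a, ha, rfl⟩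
      exact ⟨Finsupp.equivFunOnFinite.symm a, ha, rfl⟩
    · rintro ⟨m, hm, rfl⟩
      exact ⟨m, hm, by simp [xpow]⟩
  rw [shapeIdeal, himage, MvPolynomial.mem_ideal_span_monomial_image]
  refine forall₂_congr fun m _ => ⟨?_, fun h => ⟨m, h, le_rfl⟩⟩
  rintro ⟨m', hm', hle⟩ hm
  exact hm' (hσ hle hm)

theorem restrictScalars_shapeIdeal {σ : Finset (Fin 3 → ℕ)}
    (hσ : IsLowerSet (σ : Set (Fin 3 → ℕ))) :
    (shapeIdeal k σ).restrictScalars k = Submodule.span k (xpow k '' {a | a ∉ σ}) := by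
  apply le_antisymm
  · intro f hf
    rw [Submodule.restrictScalars_mem, mem_shapeIdeal hσ] at hf
    rw [f.as_sum]
    refine Submodule.sum_mem _ fun m hm => ?_
    have : MvPolynomial.monomial m (f.coeff m) = f.coeff m • xpow k m := by
      simp [xpow, MvPolynomial.smul_monomial]
    rw [this]
    exact Submodule.smul_mem _ _ (Submodule.subset_span ⟨m, hf m hm, rfl⟩)
  · rw [Submodule.span_le]
    rintro _ ⟨a, ha, rfl⟩
    exact xpow_mem_shapeIdeal ha

theorem span_range_xpow : Submodule.span k (Set.range (xpow k)) = ⊤ := by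
  rw [← top_le_iff, ← (MvPolynomial.basisMonomials (Fin 3) k).span_eq, Submodule.span_le]
  rintro _ ⟨m, rfl⟩
  exact Submodule.subset_span ⟨m, by simp [xpow]⟩

theorem shapeIdeal_anti {σ τ : Finset (Fin 3 → ℕ)} (h : σ ⊆ τ) :
    shapeIdeal k τ ≤ shapeIdeal k σ :=
  Ideal.span_mono (Set.image_mono fun _ ha hσ => ha (h hσ))

/-- Reading off the coefficients at the exponents in `σ` maps `S` onto `k^σ`, with the ideal as
kernel. -/
theorem rank_quotient_shapeIdeal {σ : Finset (Fin 3 → ℕ)}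
    (hσ : IsLowerSet (σ : Set (Fin 3 → ℕ))) :
    Module.rank k (MvPolynomial (Fin 3) k ⧸ shapeIdeal k σ) = σ.card := by
  let r : MvPolynomial (Fin 3) k →ₗ[k] (σ → k) :=
    LinearMap.pi fun a => MvPolynomial.lcoeff k (Finsupp.equivFunOnFinite.symm (a : Fin 3 → ℕ))
  have hr : Function.Surjective r := by
    intro g
    refine ⟨∑ a : σ, g a • xpow k a, ?_⟩
    funext a
    simp [r, xpow, MvPolynomial.coeff_monomial]
  have hker : LinearMap.ker r = (shapeIdeal k σ).restrictScalars k := by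
    ext f
    rw [LinearMap.mem_ker, Submodule.restrictScalars_mem, mem_shapeIdeal hσ]
    constructor
    · intro h m hm hmσ
      have := congrFun h ⟨m, hmσ⟩
      simp [r] at this
      exact MvPolynomial.mem_support_iff.1 hm this
    · intro h
      funext a
      by_contra hne
      exact h (Finsupp.equivFunOnFinite.symm (a : Fin 3 → ℕ))
        (MvPolynomial.mem_support_iff.2 (by simpa [r] using hne)) (by simp)
  have e₁ := Submodule.Quotient.restrictScalarsEquiv k (shapeIdeal k σ)
  have e₂ := (Submodule.quotEquivOfEq _ _ hker).symm.trans (r.quotKerEquivOfSurjective hr)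
  rw [← e₁.rank_eq, e₂.rank_eq, rank_fun']
  simp

end MonomialIdeals

/-! ### The translation map between the two sides -/

section Translation

variable {k : Type*} [Field k] {ℓ : ℕ} {ν : Fin ℓ → Finset (Fin 3 → ℕ)}
  {B C : Fin ℓ → (Fin 3 → ℕ)}

theorem unionShape_subset_sideShape : unionShape ν B ⊆ sideShape ν B := subset_downClosure _

theorem IsScaffold.isLowerSet_sdiff (hB : IsScaffold ν B) :
    IsLowerSet ((sideShape ν B \ unionShape ν B : Finset (Fin 3 → ℕ)) : Set (Fin 3 → ℕ)) := by
  intro v u huv hv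
  rw [Finset.mem_coe, Finset.mem_sdiff] at hv ⊢
  refine ⟨isLowerSet_sideShape B huv hv.1, fun hu => hv.2 ?_⟩
  obtain ⟨j, w, hw, rfl⟩ := mem_unionShape.1 hu
  obtain ⟨w', hw', rfl⟩ := mem_shiftShape.1 (hB.2 j _ (add_mem_shiftShape.2 hw) v hv.1 huv)
  exact mem_unionShape.2 ⟨j, w', hw', rfl⟩

theorem IsScaffold.eq_of_add_eq (hB : IsScaffold ν B) {i j : Fin ℓ} {v w : Fin 3 → ℕ}
    (hv : v ∈ ν i) (hw : w ∈ ν j) (h : v + B i = w + B j) : i = j ∧ v = w := by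
  have hij : i = j := by
    by_contra hij
    exact Finset.disjoint_left.1 (hB.1 i j hij) (add_mem_shiftShape.2 hv)
      (h ▸ add_mem_shiftShape.2 hw)
  subst hij
  exact ⟨rfl, add_right_cancel h⟩

/-- The conclusion does not involve `B`, so whether a product of monomials survives can be compared
between `B` and `C`. -/
theorem IsScaffold.add_mem (hB : IsScaffold ν B) {j : Fin ℓ} {a w : Fin 3 → ℕ} (hw : w ∈ ν j)
    (h : a + (w + B j) ∈ sideShape ν B) : a + w ∈ ν j := by
  have := hB.2 j _ (add_mem_shiftShape.2 hw) _ h le_add_self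
  rwa [← add_assoc, add_mem_shiftShape] at this

variable (k ν B C)

open Classical in
/-- The `k`-linear map with `x^{w + B_j} ↦ x^{w + C_j}` for `w ∈ ν_j`, and which vanishes on all
other monomials. -/
noncomputable def monomialShift : MvPolynomial (Fin 3) k →ₗ[k] MvPolynomial (Fin 3) k :=
  (MvPolynomial.basisMonomials (Fin 3) k).constr k fun m =>
    if h : ∃ p : (_ : Fin ℓ) × (Fin 3 → ℕ), p.2 ∈ ν p.1 ∧ p.2 + B p.1 = m then
      xpow k (h.choose.2 + C h.choose.1) else 0

variable {k ν B C}

theorem IsScaffold.monomialShift_xpow_add (hB : IsScaffold ν B) {j : Fin ℓ} {w : Fin 3 → ℕ}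
    (hw : w ∈ ν j) : monomialShift k ν B C (xpow k (w + B j)) = xpow k (w + C j) := by
  have h : ∃ p : (_ : Fin ℓ) × (Fin 3 → ℕ), p.2 ∈ ν p.1 ∧
      p.2 + B p.1 = (Finsupp.equivFunOnFinite.symm (w + B j) : Fin 3 →₀ ℕ) := ⟨⟨j, w⟩, hw, rfl⟩
  rw [monomialShift, xpow_eq_basisMonomials, Module.Basis.constr_basis, dif_pos h]
  obtain ⟨h₁, h₂⟩ := hB.eq_of_add_eq h.choose_spec.1 hw h.choose_spec.2
  rw [h₂, h₁]

theorem monomialShift_xpow_of_notMem {u : Fin 3 → ℕ} (hu : u ∉ unionShape ν B) :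
    monomialShift k ν B C (xpow k u) = 0 := by
  rw [monomialShift, xpow_eq_basisMonomials, Module.Basis.constr_basis, dif_neg]
  rintro ⟨⟨j, w⟩, hw, h⟩
  exact hu (mem_unionShape.2 ⟨j, w, hw, h⟩)

theorem monomialShift_eq_zero {f : MvPolynomial (Fin 3) k}
    (hf : f ∈ shapeIdeal k (sideShape ν B)) : monomialShift k ν B C f = 0 := by
  rw [← Submodule.restrictScalars_mem k,
    restrictScalars_shapeIdeal (isLowerSet_sideShape B)] at hf
  refine (Submodule.span_le (p := LinearMap.ker (monomialShift k ν B C))).2 ?_ hf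
  rintro _ ⟨u, hu, rfl⟩
  exact monomialShift_xpow_of_notMem fun h => hu (unionShape_subset_sideShape h)

theorem monomialShift_mem (hB : IsScaffold ν B) (f : MvPolynomial (Fin 3) k) :
    monomialShift k ν B C f ∈ shapeIdeal k (sideShape ν C \ unionShape ν C) := by
  have hf : f ∈ Submodule.span k (Set.range (xpow k)) := by
    rw [span_range_xpow]
    exact Submodule.mem_top
  refine (Submodule.span_le (p := ((shapeIdeal k (sideShape ν C \ unionShape ν C)).restrictScalars
    k).comap (monomialShift k ν B C))).2 ?_ hf
  rintro _ ⟨u, rfl⟩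
  rw [SetLike.mem_coe, Submodule.mem_comap, Submodule.restrictScalars_mem]
  by_cases hu : u ∈ unionShape ν B
  · obtain ⟨j, w, hw, rfl⟩ := mem_unionShape.1 hu
    rw [hB.monomialShift_xpow_add hw]
    refine xpow_mem_shapeIdeal fun h => (Finset.mem_sdiff.1 h).2 ?_
    exact mem_unionShape.2 ⟨j, w, hw, rfl⟩
  · rw [monomialShift_xpow_of_notMem hu]
    exact zero_mem _

/-- For `u = w + B j`, either `a + w ∈ ν j` and both terms agree, or the product leaves the piece:
then the first term is zero and the second lies in the ideal of the `C` side. For `u` outside the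
closure both terms vanish. -/
theorem monomialShift_xpow_mul_xpow (hB : IsScaffold ν B) (hC : IsScaffold ν C) (a : Fin 3 → ℕ)
    {u : Fin 3 → ℕ} (hu : u ∉ sideShape ν B \ unionShape ν B) :
    monomialShift k ν B C (xpow k a * xpow k u) - xpow k a * monomialShift k ν B C (xpow k u) ∈
      shapeIdeal k (sideShape ν C) := by
  rw [← xpow_add]
  by_cases hζ : u ∈ unionShape ν B
  · obtain ⟨j, w, hw, rfl⟩ := mem_unionShape.1 hζ
    rw [hB.monomialShift_xpow_add hw, ← xpow_add, ← add_assoc, ← add_assoc]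
    by_cases haw : a + w ∈ ν j
    · rw [hB.monomialShift_xpow_add haw, sub_self]
      exact zero_mem _
    · rw [monomialShift_xpow_of_notMem, zero_sub, neg_mem_iff]
      · refine xpow_mem_shapeIdeal fun h => haw (hC.add_mem hw ?_)
        rwa [← add_assoc]
      · refine fun h => haw (hB.add_mem hw ?_)
        rw [← add_assoc]
        exact unionShape_subset_sideShape h
  · have hside : u ∉ sideShape ν B := fun h => hu (Finset.mem_sdiff.2 ⟨h, hζ⟩)
    rw [monomialShift_xpow_of_notMem hζ, monomialShift_xpow_of_notMem, mul_zero, sub_zero]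
    · exact zero_mem _
    · exact fun h => hside (isLowerSet_sideShape B le_add_self (unionShape_subset_sideShape h))

theorem monomialShift_mul_sub_mem (hB : IsScaffold ν B) (hC : IsScaffold ν C)
    (p : MvPolynomial (Fin 3) k) {f : MvPolynomial (Fin 3) k}
    (hf : f ∈ shapeIdeal k (sideShape ν B \ unionShape ν B)) :
    monomialShift k ν B C (p * f) - p * monomialShift k ν B C f ∈
      shapeIdeal k (sideShape ν C) := by
  rw [← Submodule.restrictScalars_mem k, restrictScalars_shapeIdeal hB.isLowerSet_sdiff] at hf
  have hp : p ∈ Submodule.span k (Set.range (xpow k)) := by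
    rw [span_range_xpow]
    exact Submodule.mem_top
  induction hf using Submodule.span_induction with
  | mem f hf =>
    obtain ⟨u, hu, rfl⟩ := hf
    induction hp using Submodule.span_induction with
    | mem p hp =>
      obtain ⟨a, rfl⟩ := hp
      exact monomialShift_xpow_mul_xpow hB hC a hu
    | zero => simp
    | add p q _ _ hp hq =>
      convert add_mem hp hq using 1
      rw [add_mul, map_add]
      ring
    | smul t p _ hp =>
      convert Submodule.smul_of_tower_mem _ t hp using 1
      rw [smul_mul_assoc, smul_mul_assoc, map_smul, smul_sub]
  | zero => simp
  | add f g _ _ hf hg =>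
    convert add_mem hf hg using 1
    rw [mul_add, map_add, map_add]
    ring
  | smul t f _ hf =>
    convert Submodule.smul_of_tower_mem _ t hf using 1
    rw [mul_smul_comm, map_smul, map_smul, mul_smul_comm, smul_sub]

theorem xpow_mem_shapeIdeal_sdiff {j : Fin ℓ} {w : Fin 3 → ℕ} (hw : w ∈ ν j) :
    xpow k (w + B j) ∈ shapeIdeal k (sideShape ν B \ unionShape ν B) :=
  xpow_mem_shapeIdeal fun h => (Finset.mem_sdiff.1 h).2 (mem_unionShape.2 ⟨j, w, hw, rfl⟩)

theorem exists_lift_of_surjective {R M N P : Type*} [Ring R] [AddCommGroup M] [AddCommGroup N]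
    [AddCommGroup P] [Module R M] [Module R N] [Module R P] (q : M →ₗ[R] N)
    (hq : Function.Surjective q) (g : M →ₗ[R] P) (h : LinearMap.ker q ≤ LinearMap.ker g) :
    ∃ φ : N →ₗ[R] P, ∀ m, φ (q m) = g m := by
  refine ⟨(Submodule.liftQ _ g h).comp (q.quotKerEquivOfSurjective hq).symm.toLinearMap,
    fun m => ?_⟩
  have : (q.quotKerEquivOfSurjective hq).symm (q m) = Submodule.Quotient.mk m := by
    rw [LinearEquiv.symm_apply_eq]
    rfl
  rw [LinearMap.comp_apply, LinearEquiv.coe_coe, this]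
  exact Submodule.liftQ_apply _ _ _

/-- An additive map `S → S` that maps `I` to `0` and `K` to `L`, and that is `S`-linear modulo `J`
on `K`, induces a linear map `K / I → L / J`. -/
theorem exists_subquotient_hom {S : Type*} [CommRing S] {I J K L : Ideal S} (t : S →+ S)
    (hI : ∀ f ∈ I, t f = 0) (hL : ∀ f, t f ∈ L)
    (hmul : ∀ p, ∀ f ∈ K, t (p * f) - p * t f ∈ J) :
    ∃ φ : subquotient I K →ₗ[S] subquotient J L, ∀ f ∈ K, ∀ f' : subquotient I K,
      (f' : S ⧸ I) = Ideal.Quotient.mk I f →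
        (φ f' : S ⧸ J) = Ideal.Quotient.mk J (t f) := by
  let g : K →ₗ[S] subquotient J L :=
    { toFun := fun f => ⟨Submodule.mkQ J (t f), Submodule.mem_map_of_mem (hL f)⟩
      map_add' := fun f f' => Subtype.ext (by simp)
      map_smul' := fun p f => Subtype.ext ((Submodule.Quotient.eq J).2 (hmul p f f.2)) }
  obtain ⟨φ, hφ⟩ := exists_lift_of_surjective ((Submodule.mkQ I).submoduleMap K)
    (LinearMap.submoduleMap_surjective _ _) g (by
      intro f hf
      have hf' : (f : S) ∈ I :=
        (Submodule.Quotient.mk_eq_zero _).1 (congrArg Subtype.val (LinearMap.mem_ker.1 hf))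
      refine LinearMap.mem_ker.2 (Subtype.ext ?_)
      change Submodule.mkQ J (t f) = 0
      rw [hI f hf', map_zero])
  refine ⟨φ, fun f hf f' hf' => ?_⟩
  have hfe : f' = (Submodule.mkQ I).submoduleMap K ⟨f, hf⟩ := Subtype.ext hf'
  rw [hfe]
  exact congrArg Subtype.val (hφ ⟨f, hf⟩)

theorem exists_translation_hom (hB : IsScaffold ν B) (hC : IsScaffold ν C) :
    ∃ φ : sideModule k ν B →ₗ[MvPolynomial (Fin 3) k] sideModule k ν C,
      ∀ j, ∀ w ∈ ν j, ∀ f : sideModule k ν B,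
        (f : MvPolynomial (Fin 3) k ⧸ shapeIdeal k (sideShape ν B)) =
          Ideal.Quotient.mk _ (xpow k (w + B j)) →
        (φ f : MvPolynomial (Fin 3) k ⧸ shapeIdeal k (sideShape ν C)) =
          Ideal.Quotient.mk _ (xpow k (w + C j)) := by
  obtain ⟨φ, hφ⟩ := exists_subquotient_hom (I := shapeIdeal k (sideShape ν B))
    (J := shapeIdeal k (sideShape ν C)) (K := shapeIdeal k (sideShape ν B \ unionShape ν B))
    (L := shapeIdeal k (sideShape ν C \ unionShape ν C)) (monomialShift k ν B C).toAddMonoidHom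
    (fun f hf => monomialShift_eq_zero hf) (monomialShift_mem hB)
    (fun p f hf => monomialShift_mul_sub_mem hB hC p hf)
  refine ⟨φ, fun j w hw f hf => ?_⟩
  refine (hφ _ (xpow_mem_shapeIdeal_sdiff hw) f hf).trans (congrArg _ ?_)
  exact hB.monomialShift_xpow_add hw

open Classical in
theorem sideModule_le_span (hB : IsScaffold ν B) :
    (sideModule k ν B).restrictScalars k ≤ Submodule.span k
      (((unionShape ν B).image fun u => Ideal.Quotient.mk (shapeIdeal k (sideShape ν B))
        (xpow k u) : Finset _) : Set (MvPolynomial (Fin 3) k ⧸ shapeIdeal k (sideShape ν B))) := by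
  rintro _ ⟨f, hf, rfl⟩
  rw [SetLike.mem_coe, ← Submodule.restrictScalars_mem k,
    restrictScalars_shapeIdeal hB.isLowerSet_sdiff] at hf
  refine (Submodule.span_le (p := (Submodule.span k _).comap
    ((Submodule.mkQ (shapeIdeal k (sideShape ν B))).restrictScalars k))).2 ?_ hf
  rintro _ ⟨u, hu, rfl⟩
  rw [SetLike.mem_coe, Submodule.mem_comap]
  by_cases hζ : u ∈ unionShape ν B
  · exact Submodule.subset_span (Finset.mem_coe.2 (Finset.mem_image_of_mem _ hζ))
  · have hzero : (Submodule.mkQ (shapeIdeal k (sideShape ν B))).restrictScalars k (xpow k u) = 0 :=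
      (Submodule.Quotient.mk_eq_zero _).2
        (xpow_mem_shapeIdeal fun h => hu (Finset.mem_sdiff.2 ⟨h, hζ⟩))
    rw [hzero]
    exact zero_mem _

end Translation

/-! ### Inverse translations, gluing and the dimension count -/

/-- The vectors fixed by `ψ` form a submodule; its image `E` in `M` contains `X`, hence the `k`-span
of `X`. -/
theorem linearMap_eq_id_of_span {k S M : Type*} [CommRing k] [CommRing S] [Algebra k S]
    [AddCommGroup M] [Module S M] [Module k M] [IsScalarTower k S M] {W : Submodule S M}
    {X : Set M} (hXW : X ⊆ W) (hspan : W.restrictScalars k ≤ Submodule.span k X)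
    (ψ : W →ₗ[S] W) (hψ : ∀ f : W, (f : M) ∈ X → ψ f = f) : ψ = LinearMap.id := by
  let E : Submodule S M := (LinearMap.ker (ψ - LinearMap.id)).map W.subtype
  have hXE : Submodule.span k X ≤ E.restrictScalars k := by
    rw [Submodule.span_le]
    intro x hx
    refine ⟨⟨x, hXW hx⟩, ?_, rfl⟩
    rw [SetLike.mem_coe, LinearMap.mem_ker, LinearMap.sub_apply, LinearMap.id_apply,
      hψ ⟨x, hXW hx⟩ hx, sub_self]
  ext1 f
  obtain ⟨f', hf', h⟩ := hXE (hspan f.2)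
  obtain rfl : f' = f := Subtype.ext h
  exact sub_eq_zero.1 (LinearMap.mem_ker.1 hf')

section Gluing

variable {k : Type*} [Field k] {ℓ : ℕ} {ν : Fin ℓ → Finset (Fin 3 → ℕ)}
  {B C : Fin ℓ → (Fin 3 → ℕ)}

theorem IsScaffold.comp_eq_id (hB : IsScaffold ν B)
    (φ : sideModule k ν B →ₗ[MvPolynomial (Fin 3) k] sideModule k ν C)
    (ψ : sideModule k ν C →ₗ[MvPolynomial (Fin 3) k] sideModule k ν B)
    (hφ : ∀ j, ∀ w ∈ ν j, ∀ f : sideModule k ν B,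
      (f : MvPolynomial (Fin 3) k ⧸ shapeIdeal k (sideShape ν B)) =
        Ideal.Quotient.mk _ (xpow k (w + B j)) →
      (φ f : MvPolynomial (Fin 3) k ⧸ shapeIdeal k (sideShape ν C)) =
        Ideal.Quotient.mk _ (xpow k (w + C j)))
    (hψ : ∀ j, ∀ w ∈ ν j, ∀ f : sideModule k ν C,
      (f : MvPolynomial (Fin 3) k ⧸ shapeIdeal k (sideShape ν C)) =
        Ideal.Quotient.mk _ (xpow k (w + C j)) →
      (ψ f : MvPolynomial (Fin 3) k ⧸ shapeIdeal k (sideShape ν B)) =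
        Ideal.Quotient.mk _ (xpow k (w + B j))) :
    ψ ∘ₗ φ = LinearMap.id := by
  classical
  refine linearMap_eq_id_of_span ?_ (sideModule_le_span hB) _ ?_
  · intro x hx
    obtain ⟨u, hu, rfl⟩ := Finset.mem_image.1 (Finset.mem_coe.1 hx)
    obtain ⟨j, w, hw, rfl⟩ := mem_unionShape.1 hu
    exact Submodule.mem_map_of_mem (f := Submodule.mkQ (shapeIdeal k (sideShape ν B)))
      (xpow_mem_shapeIdeal_sdiff hw)
  · intro f hf
    obtain ⟨u, hu, h⟩ := Finset.mem_image.1 (Finset.mem_coe.1 hf)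
    obtain ⟨j, w, hw, rfl⟩ := mem_unionShape.1 hu
    exact Subtype.ext ((hψ j w hw _ (hφ j w hw f h.symm)).trans h)

theorem exists_isTranslationMap (hB : IsScaffold ν B) (hC : IsScaffold ν C) :
    ∃ φ : sideModule k ν B ≃ₗ[MvPolynomial (Fin 3) k] sideModule k ν C, IsTranslationMap φ := by
  obtain ⟨φ, hφ⟩ := exists_translation_hom (k := k) hB hC
  obtain ⟨ψ, hψ⟩ := exists_translation_hom (k := k) hC hB
  exact ⟨LinearEquiv.ofLinearMap φ ψ (hC.comp_eq_id ψ φ hψ hφ) (hB.comp_eq_id φ ψ hφ hψ), hφ⟩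

/-- The generators `(f, -φ f)` already form a submodule, the image of `K/I` under a linear map. -/
theorem rank_gluingSubmodule_le {k S : Type*} [Field k] [CommRing S] [Algebra k S]
    {I J K L : Ideal S} (φ : subquotient I K ≃ₗ[S] subquotient J L) :
    Module.rank k (gluingSubmodule φ) ≤ Module.rank k (subquotient I K) := by
  let g : subquotient I K →ₗ[S] (S ⧸ I) × (S ⧸ J) :=
    (subquotient I K).subtype.prod (-((subquotient J L).subtype ∘ₗ φ.toLinearMap))
  have hg : gluingSubmodule φ = LinearMap.range g := by
    refine le_antisymm (Submodule.span_le.2 ?_) ?_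
    · rintro _ ⟨f, rfl⟩
      exact ⟨f, rfl⟩
    · rintro _ ⟨f, rfl⟩
      exact Submodule.subset_span ⟨f, rfl⟩
  rw [hg]
  exact LinearMap.rank_le_of_surjective (g.rangeRestrict.restrictScalars k)
    g.surjective_rangeRestrict

theorem rank_gluedModule_add {k S : Type*} [Field k] [CommRing S] [Algebra k S]
    {I J K L : Ideal S} (φ : subquotient I K ≃ₗ[S] subquotient J L) :
    Module.rank k (GluedModule φ) + Module.rank k (gluingSubmodule φ) =
      Module.rank k (S ⧸ I) + Module.rank k (S ⧸ J) := by
  have e := Submodule.Quotient.restrictScalarsEquiv k (gluingSubmodule φ)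
  rw [← rank_prod' (M := S ⧸ I) (M₁ := S ⧸ J),
    ← Submodule.rank_quotient_add_rank ((gluingSubmodule φ).restrictScalars k),
    e.rank_eq]
  rfl

theorem le_annihilator_gluedModule {S : Type*} [CommRing S] {I J K L A : Ideal S}
    (hI : A ≤ I) (hJ : A ≤ J) (φ : subquotient I K ≃ₗ[S] subquotient J L) :
    A ≤ Module.annihilator S (GluedModule φ) := by
  intro p hp
  rw [Module.mem_annihilator]
  intro x
  obtain ⟨⟨f, g⟩, rfl⟩ := Submodule.Quotient.mk_surjective _ x
  obtain ⟨f, rfl⟩ := Submodule.Quotient.mk_surjective _ f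
  obtain ⟨g, rfl⟩ := Submodule.Quotient.mk_surjective _ g
  rw [← Submodule.Quotient.mk_smul, Prod.smul_mk, ← Submodule.Quotient.mk_smul,
    ← Submodule.Quotient.mk_smul, smul_eq_mul, smul_eq_mul,
    (Submodule.Quotient.mk_eq_zero I).2 (I.mul_mem_right f (hI hp)),
    (Submodule.Quotient.mk_eq_zero J).2 (J.mul_mem_right g (hJ hp))]
  exact Submodule.Quotient.mk_zero _

theorem rank_sideModule_le (hB : IsScaffold ν B) :
    Module.rank k (sideModule k ν B) ≤ (∑ j, (ν j).card : ℕ) := by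
  classical
  refine (Submodule.rank_mono (sideModule_le_span hB)).trans
    ((rank_span_finset_le _).trans (Nat.cast_le.2 (Finset.card_image_le.trans ?_)))
  exact Finset.card_biUnion_le.trans (Finset.sum_le_sum fun j _ => Finset.card_image_le)

theorem not_isCounterexampleModule (hB : IsScaffold ν B)
    (hcard : ∑ j, (ν j).card ≤ (sideShape ν B ∩ sideShape ν C).card)
    (φ : sideModule k ν B ≃ₗ[MvPolynomial (Fin 3) k] sideModule k ν C) :
    ¬ IsCounterexampleModule k (GluedModule φ) := by
  rw [IsCounterexampleModule, not_not]
  have hle : shapeIdeal k (sideShape ν B ∪ sideShape ν C) ≤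
      Module.annihilator (MvPolynomial (Fin 3) k) (GluedModule φ) :=
    le_annihilator_gluedModule (shapeIdeal_anti Finset.subset_union_left)
      (shapeIdeal_anti Finset.subset_union_right) φ
  have hann : Module.rank k (MvPolynomial (Fin 3) k ⧸
      Module.annihilator (MvPolynomial (Fin 3) k) (GluedModule φ)) ≤
        ((sideShape ν B ∪ sideShape ν C).card : Cardinal) := by
    rw [← rank_quotient_shapeIdeal (k := k)]
    · exact LinearMap.rank_le_of_surjective (Ideal.Quotient.factorₐ k hle).toLinearMap
        (Ideal.Quotient.factor_surjective hle)
    · rw [Finset.coe_union]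
      exact (isLowerSet_sideShape B).union (isLowerSet_sideShape C)
  have hglue : Module.rank k (gluingSubmodule φ) ≤ (∑ j, (ν j).card : ℕ) :=
    (rank_gluingSubmodule_le φ).trans (rank_sideModule_le hB)
  have hadd := rank_gluedModule_add (k := k) φ
  rw [rank_quotient_shapeIdeal (isLowerSet_sideShape B),
    rank_quotient_shapeIdeal (isLowerSet_sideShape C), ← Nat.cast_add,
    ← Finset.card_union_add_card_inter, Nat.cast_add] at hadd
  -- Ranks are cardinals, so |ν| may be cancelled only because it is finite.
  rw [← Cardinal.add_le_add_iff_of_lt_aleph0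
    (Cardinal.natCast_lt_aleph0 (n := ∑ j, (ν j).card))]
  calc _ ≤ ((sideShape ν B ∪ sideShape ν C).card : Cardinal) +
        ((sideShape ν B ∩ sideShape ν C).card : Cardinal) :=
        add_le_add hann (Nat.cast_le.2 hcard)
    _ = _ := hadd.symm
    _ ≤ _ := add_le_add le_rfl hglue

end Gluing

theorem mainTheorem2 {k : Type*} [Field k] {ℓ : ℕ} (F : FloorPlan ℓ)
    (hb : HasHeights F.ν F.b) (hc : HasHeights F.ν F.c) (hF : F.IsRightFree) :
    -- the canonical realization gives rise to a combinatorial module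
    (IsScaffold F.ν F.canonicalB ∧ IsScaffold F.ν F.canonicalC ∧
      ∃ φ : sideModule k F.ν F.canonicalB ≃ₗ[MvPolynomial (Fin 3) k]
        sideModule k F.ν F.canonicalC, IsTranslationMap φ) ∧
    -- `|ν| ≤ |λ ∩ μ|`
    ∑ j, (F.ν j).card ≤ (sideShape F.ν F.canonicalB ∩ sideShape F.ν F.canonicalC).card ∧
    -- that module is not a counterexample
    ∀ φ : sideModule k F.ν F.canonicalB ≃ₗ[MvPolynomial (Fin 3) k]
        sideModule k F.ν F.canonicalC,
      IsTranslationMap φ → ¬ IsCounterexampleModule k (GluedModule φ) := by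
  have hB : IsScaffold F.ν F.canonicalB := isScaffold_canonicalLift F.isSkewShape hb
  have hC : IsScaffold F.ν F.canonicalC := isScaffold_canonicalLift F.isSkewShape hc
  have hcard := F.sum_card_le hb hF
  exact ⟨⟨hB, hC, exists_isTranslationMap hB hC⟩, hcard,
    fun φ _ => not_isCounterexampleModule hB hcard φ⟩
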